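/- Let $K$ be a unital commutative $\mathbb{Q}$-algebra, $n\ge 0$, and $z=(z_1,\dots,z_n)$ commutative or noncommutative free variables. Let $K\langle\langle z\rangle\rangle$ be the algebra of formal power series in $z$ over $K$. For $U=(U_1,\dots,U_n)\in K\langle\langle z\rangle\rangle^{\times n}$ let $[U\frac{\partial}{\partial z}]$ be the $K$-derivation of $K\langle\langle z\rangle\rangle$ with $z_i\mapsto U_i$ for all $i$. For $H\in K\langle\langle z\rangle\rangle^{\times n}$ put $C_1=H$, $C_k=[C_{k-1}\frac{\partial}{\partial z}]H$ (componentwise) for $k\ge 2$, and $\psi_k=[C_k\frac{\partial}{\partial z}]$ for $k\ge1$. Let $w=(w_1,\dots,w_n)$ be further free variables independent of $z$; for a power series $u(z)$, let $\left.[H(w)\frac{\partial}{\partial z}]^m u\,\right|_{w=z}$ be obtained by applying $m$ times the derivation of $K\langle\langle z,w\rangle\rangle$ with $z_i\mapsto H_i(w)$, $w_i\mapsto 0$ to $u(z)$ and then replacing $w$ by $z$. For $m\ge1$ let $\mathcal C_m$ be the set of compositions $I=(i_1,\dots,i_\ell)$ of $m$ into positive integers; put $\ell(I)=\ell$, $\bar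 I=(i_\ell,\dots,i_1)$, $\pi_u(I)=\prod_{j=1}^{\ell}(i_1+\cdots+i_j)$ and $\psi^I=\psi_{i_1}\psi_{i_2}\cdots\psi_{i_\ell}$ (composition of operators). Then for every $m\ge1$ and every $H\in K\langle\langle z\rangle\rangle^{\times n}$, as operators on $K\langle\langle z\rangle\rangle$, in both the commutative and the noncommutative case, $$\frac1{m!}\left.\Big[H(w)\frac{\partial}{\partial z}\Big]^m\right|_{w=z}=(-1)^m\sum_{I\in\mathcal C_m}\frac{(-1)^{\ell(I)}}{\pi_u(\bar I)}\,\psi^I .$$ In particular, when the variables $z$ are commutative, with $JH=(\partial H_i/\partial z_j)$ the Jacobian matrix of $H$, $$\psi_m=\sum_{i=1}^n\big((JH)^{m-1}H\big)_i\,\frac{\partial}{\partial z_i},\qquad \sum_{\substack{I\in\mathbb N^n\\ |I|=m}}\frac1{I!}\,H^I(z)\,\frac{\partial^m}{\partial z^I}=(-1)^m\sum_{I\in\mathcal C_m}\frac{(-1)^{\ell(I)}}{\pi_u(\bar I)}\,\psi^I .$$ -/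

import Mathlib

open Finset
open scoped Nat

/-- `NCPowerSeries σ K` is the algebra `K⟨⟨z⟩⟩` of formal power series over `K` in the
noncommutative free variables `z = (z_i)_{i ∈ σ}`: a series is the family of its coefficients,
indexed by the words in the letters `z_i`. -/
structure NCPowerSeries (σ K : Type*) where
  /-- The coefficient of a series at a word. -/
  coeff : List σ → K

namespace NCPowerSeries

variable {σ τ K : Type*}

instance : CoeFun (NCPowerSeries σ K) fun _ => List σ → K := ⟨coeff⟩

@[ext] theorem ext' {f g : NCPowerSeries σ K} (h : ∀ w, f w = g w) : f = g := by
  cases f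
  cases g
  congr
  exact funext h

/-- A series is the same as the family of its coefficients. -/
def coeffEquiv : NCPowerSeries σ K ≃ (List σ → K) := ⟨coeff, mk, fun _ => rfl, fun _ => rfl⟩

section Algebra

variable [CommRing K]

noncomputable instance : AddCommGroup (NCPowerSeries σ K) :=
  coeffEquiv.addCommGroup

noncomputable instance : Module K (NCPowerSeries σ K) :=
  coeffEquiv.module K

/-- The Cauchy product: the coefficient at the word `w` is the sum over all factorizations
`w = u v` into two words. -/
noncomputable instance : Mul (NCPowerSeries σ K) :=
  ⟨fun f g => ⟨fun w => ∑ k ∈ range (w.length + 1), f (w.take k) * g (w.drop k)⟩⟩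

noncomputable instance : One (NCPowerSeries σ K) :=
  ⟨⟨fun w => match w with
    | [] => 1
    | _ :: _ => 0⟩⟩

/-- The series `f_a` with coefficients `f_a (w) = f (a w)`. -/
def tailAt (a : σ) (f : NCPowerSeries σ K) : NCPowerSeries σ K :=
  ⟨fun w => f (a :: w)⟩

theorem add_apply (f g : NCPowerSeries σ K) (w : List σ) : (f + g) w = f w + g w := rfl
theorem zero_apply (w : List σ) : (0 : NCPowerSeries σ K) w = 0 := rfl
theorem smul_apply (c : K) (f : NCPowerSeries σ K) (w : List σ) : (c • f) w = c * f w := rfl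
theorem one_nil : (1 : NCPowerSeries σ K) [] = 1 := rfl
theorem one_cons (a : σ) (w : List σ) : (1 : NCPowerSeries σ K) (a :: w) = 0 := rfl

theorem sum_apply {ι : Type*} (s : Finset ι) (f : ι → NCPowerSeries σ K) (w : List σ) :
    (∑ i ∈ s, f i) w = ∑ i ∈ s, f i w := by
  classical
  induction s using Finset.induction_on with
  | empty => rfl
  | insert a s ha ih => rw [sum_insert ha, sum_insert ha, add_apply, ih]

theorem mul_apply (f g : NCPowerSeries σ K) (w : List σ) :
    (f * g) w = ∑ k ∈ range (w.length + 1), f (w.take k) * g (w.drop k) := rfl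

theorem mul_nil (f g : NCPowerSeries σ K) : (f * g) [] = f [] * g [] := by
  simp [mul_apply]

theorem mul_cons (f g : NCPowerSeries σ K) (a : σ) (w : List σ) :
    (f * g) (a :: w) = f [] * g (a :: w) + (tailAt a f * g) w := by
  rw [mul_apply, mul_apply, List.length_cons, sum_range_succ', add_comm]
  simp [tailAt]

theorem tailAt_mul (f g : NCPowerSeries σ K) (a : σ) :
    tailAt a (f * g) = f [] • tailAt a g + tailAt a f * g := by
  ext w
  exact mul_cons f g a w

theorem add_mul' (f g h : NCPowerSeries σ K) : (f + g) * h = f * h + g * h := by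
  ext w
  simp only [mul_apply, add_apply, add_mul, sum_add_distrib]

theorem mul_add' (f g h : NCPowerSeries σ K) : f * (g + h) = f * g + f * h := by
  ext w
  simp only [mul_apply, add_apply, mul_add, sum_add_distrib]

theorem smul_mul' (c : K) (f g : NCPowerSeries σ K) : (c • f) * g = c • (f * g) := by
  ext w
  simp only [mul_apply, smul_apply, mul_sum, mul_assoc]

theorem mul_smul' (c : K) (f g : NCPowerSeries σ K) : f * (c • g) = c • (f * g) := by
  ext w
  simp only [mul_apply, smul_apply, mul_sum, mul_left_comm]

theorem mul_assoc' (f g h : NCPowerSeries σ K) : f * g * h = f * (g * h) := by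
  ext w
  induction w generalizing f with
  | nil => simp only [mul_nil, mul_assoc]
  | cons a w ih =>
    rw [mul_cons, mul_cons, tailAt_mul, add_mul', add_apply, ih, smul_mul', smul_apply,
      mul_cons g, mul_nil]
    ring

theorem zero_mul' (f : NCPowerSeries σ K) : 0 * f = 0 := by
  ext w; simp [mul_apply, zero_apply]

theorem mul_zero' (f : NCPowerSeries σ K) : f * 0 = 0 := by
  ext w; simp [mul_apply, zero_apply]

theorem one_mul' (f : NCPowerSeries σ K) : 1 * f = f := by
  ext w
  cases w with
  | nil => simp [mul_nil, one_nil]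
  | cons a w =>
    have h : tailAt a (1 : NCPowerSeries σ K) = 0 := rfl
    rw [mul_cons, h, zero_mul', one_nil, one_mul, zero_apply, add_zero]

theorem mul_one' (f : NCPowerSeries σ K) : f * 1 = f := by
  ext w
  induction w generalizing f with
  | nil => simp [mul_nil, one_nil]
  | cons a w ih => rw [mul_cons, ih, one_cons, mul_zero, zero_add]; rfl

noncomputable instance : Ring (NCPowerSeries σ K) where
  __ := (inferInstance : AddCommGroup (NCPowerSeries σ K))
  left_distrib := mul_add'
  right_distrib := add_mul'
  zero_mul := zero_mul'
  mul_zero := mul_zero'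
  mul_assoc := mul_assoc'
  one_mul := one_mul'
  mul_one := mul_one'

noncomputable instance : Algebra K (NCPowerSeries σ K) :=
  Algebra.ofModule smul_mul' fun c f g => mul_smul' c f g

/-- The variable `z_i`. -/
noncomputable def X [DecidableEq σ] (i : σ) : NCPowerSeries σ K :=
  ⟨fun w => if w = [i] then 1 else 0⟩

theorem tailAt_X [DecidableEq σ] (i j : σ) :
    tailAt j (X i : NCPowerSeries σ K) = if j = i then 1 else 0 := by
  ext w
  by_cases hj : j = i <;> cases w <;>
    simp [tailAt, X, hj, one_nil, one_cons, zero_apply]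

end Algebra

section Derivation

variable [CommRing K] [Fintype σ]

/-- The `K`-derivation `[U ∂/∂z] = ∑ i, [U_i ∂/∂z_i]` of `K⟨⟨z⟩⟩`, which maps `z_i` to `U_i` for
every `i`. It replaces, in all possible ways, one letter `z_i` of a word by `U_i`; hence the
coefficient of `[U ∂/∂z] f` at `w` is the sum of `f (a z_i b) * U_i (v)` over all letters `z_i`
and all factorizations `w = a v b`. -/
noncomputable def derivation (U : σ → NCPowerSeries σ K) : Module.End K (NCPowerSeries σ K) where
  toFun f := ⟨fun w =>
    ∑ j ∈ range (w.length + 1), ∑ l ∈ range ((w.drop j).length + 1), ∑ i : σ,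
      U i ((w.drop j).take l) * f (w.take j ++ i :: (w.drop j).drop l)⟩
  map_add' f g := by
    ext w
    rw [add_apply]
    simp only [add_apply, mul_add, sum_add_distrib]
  map_smul' c f := by
    ext w
    rw [RingHom.id_apply, smul_apply]
    simp only [smul_apply, mul_sum, mul_left_comm]

theorem derivation_apply (U : σ → NCPowerSeries σ K) (f : NCPowerSeries σ K) (w : List σ) :
    derivation U f w =
      ∑ j ∈ range (w.length + 1), ∑ l ∈ range ((w.drop j).length + 1), ∑ i : σ,
        U i ((w.drop j).take l) * f (w.take j ++ i :: (w.drop j).drop l) := rfl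

theorem derivation_aux (U : σ → NCPowerSeries σ K) (f : NCPowerSeries σ K) (w : List σ) :
    ∑ l ∈ range (w.length + 1), ∑ i : σ, U i (w.take l) * f (i :: w.drop l) =
      (∑ i, U i * tailAt i f) w := by
  rw [sum_comm, sum_apply]
  rfl

theorem derivation_nil (U : σ → NCPowerSeries σ K) (f : NCPowerSeries σ K) :
    derivation U f [] = (∑ i, U i * tailAt i f) [] := by
  rw [derivation_apply, ← derivation_aux]
  simp

theorem derivation_cons (U : σ → NCPowerSeries σ K) (f : NCPowerSeries σ K) (a : σ)
    (w : List σ) :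
    derivation U f (a :: w) =
      (∑ i, U i * tailAt i f) (a :: w) + derivation U (tailAt a f) w := by
  rw [derivation_apply, ← derivation_aux, List.length_cons, sum_range_succ', add_comm,
    derivation_apply]
  rfl

/-- `derivation U` satisfies the Leibniz rule. -/
theorem derivation_mul (U : σ → NCPowerSeries σ K) (f g : NCPowerSeries σ K) :
    derivation U (f * g) = derivation U f * g + f * derivation U g := by
  have key : ∀ f g : NCPowerSeries σ K, (∑ i, U i * tailAt i (f * g)) =
      f [] • (∑ i, U i * tailAt i g) + (∑ i, U i * tailAt i f) * g := by
    intro f g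
    simp only [tailAt_mul, mul_add, sum_add_distrib, sum_mul, smul_sum, mul_assoc,
      Algebra.mul_smul_comm]
  ext w
  induction w generalizing f with
  | nil =>
    rw [derivation_nil, key, add_apply, add_apply, mul_nil, mul_nil, mul_nil, derivation_nil,
      derivation_nil, smul_apply]
    ring
  | cons a w ih =>
    have h : tailAt a (derivation U f) =
        tailAt a (∑ i, U i * tailAt i f) + derivation U (tailAt a f) := by
      ext v
      exact derivation_cons U f a v
    rw [derivation_cons, key, add_apply, add_apply, smul_apply, tailAt_mul, map_add, add_apply, ih,
      add_apply, mul_cons (derivation U f), h, add_mul, add_apply, mul_cons f, derivation_cons,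
      derivation_nil, mul_cons (∑ i, U i * tailAt i f), map_smul, smul_apply]
    ring

/-- `derivation U` maps `z_i` to `U_i`. -/
theorem derivation_X [DecidableEq σ] (U : σ → NCPowerSeries σ K) (i : σ) :
    derivation U (X i) = U i := by
  have h2 : (∑ j, U j * tailAt j (X i : NCPowerSeries σ K)) = U i := by
    simp [tailAt_X]
  have h3 : derivation U (1 : NCPowerSeries σ K) = 0 := by
    have h := derivation_mul U 1 1
    rw [mul_one, mul_one, one_mul] at h
    simpa using h
  ext w
  cases w with
  | nil => rw [derivation_nil, h2]
  | cons a w =>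
    rw [derivation_cons, h2, tailAt_X]
    split_ifs <;> simp [h3, zero_apply]

end Derivation

section Rename

variable [CommRing K] [Fintype σ] [DecidableEq τ]

/-- The substitution `z_i ↦ z_{e i}` from series in the finitely many variables indexed by `σ` to
series in the variables indexed by `τ`: the coefficient of `rename e f` at `w` is the sum of the
coefficients of `f` at all the words `v` with `e (v) = w`. -/
noncomputable def rename (e : σ → τ) : NCPowerSeries σ K →ₗ[K] NCPowerSeries τ K where
  toFun f := ⟨fun w =>
    ∑ v : Fin w.length → σ with (List.ofFn v).map e = w, f (List.ofFn v)⟩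
  map_add' f g := by
    ext w
    rw [add_apply]
    simp only [add_apply, sum_add_distrib]
  map_smul' c f := by
    ext w
    rw [RingHom.id_apply, smul_apply]
    simp only [smul_apply, mul_sum]

theorem rename_nil (e : σ → τ) (f : NCPowerSeries σ K) : rename e f [] = f [] := by
  change ∑ v : Fin 0 → σ with (List.ofFn v).map e = [], f (List.ofFn v) = f []
  simp

theorem rename_cons (e : σ → τ) (f : NCPowerSeries σ K) (a : τ) (w : List τ) :
    rename e f (a :: w) = rename e (∑ i with e i = a, tailAt i f) w := by
  change ∑ v : Fin (w.length + 1) → σ with (List.ofFn v).map e = a :: w, f (List.ofFn v) = _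
  rw [map_sum, sum_apply, sum_filter, sum_filter,
    ← (Fin.consEquiv fun _ => σ).sum_comp, Fintype.sum_prod_type]
  refine sum_congr rfl fun i _ => ?_
  change _ = if e i = a then
    ∑ v : Fin w.length → σ with (List.ofFn v).map e = w, f (i :: List.ofFn v) else 0
  rw [sum_filter]
  by_cases h : e i = a <;> simp [Fin.consEquiv, List.ofFn_succ, h]

/-- `rename e` is multiplicative. -/
theorem rename_mul (e : σ → τ) (f g : NCPowerSeries σ K) :
    rename e (f * g) = rename e f * rename e g := by
  ext w
  induction w generalizing f with
  | nil => rw [rename_nil, mul_nil, mul_nil, rename_nil, rename_nil]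
  | cons a w ih =>
    have h : tailAt a (rename e f) = rename e (∑ i with e i = a, tailAt i f) := by
      ext v
      exact rename_cons e f a v
    rw [rename_cons, mul_cons, h, ← ih, rename_cons, rename_nil, ← smul_apply, ← map_smul,
      ← add_apply, ← map_add]
    simp only [tailAt_mul, sum_add_distrib, smul_sum, sum_mul]

/-- `rename e` maps `z_i` to `z_{e i}`. -/
theorem rename_X [DecidableEq σ] (e : σ → τ) (i : σ) :
    rename e (X i : NCPowerSeries σ K) = X (e i) := by
  have h1 : rename e (1 : NCPowerSeries σ K) = 1 := by
    ext w
    cases w with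
    | nil => rw [rename_nil, one_nil, one_nil]
    | cons a w =>
      have h : ∀ j, tailAt j (1 : NCPowerSeries σ K) = 0 := fun _ => rfl
      simp [rename_cons, h, one_cons, zero_apply]
  ext w
  cases w with
  | nil => simp [rename_nil, X]
  | cons a w =>
    have h : (X (e i) : NCPowerSeries τ K) (a :: w) = tailAt a (X (e i)) w := rfl
    rw [rename_cons, h]
    by_cases ha : a = e i
    · simp [tailAt_X, ha, h1]
    · have h2 : ∀ j ∈ (univ : Finset σ).filter (fun j => e j = a),
          tailAt j (X i : NCPowerSeries σ K) = 0 := by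
        intro j hj
        rw [tailAt_X, if_neg]
        rintro rfl
        exact ha (mem_filter.mp hj).2.symm
      rw [sum_congr rfl h2, tailAt_X, if_neg ha]
      simp

/-- The operator `[H(w) ∂/∂z]^m |_{w = z}` on `K⟨⟨z⟩⟩`, where `w` is a second set of free
variables, independent of `z`: view `u(z)` in `K⟨⟨z, w⟩⟩`, apply `m` times the derivation of
`K⟨⟨z, w⟩⟩` with `z_i ↦ H_i(w)` and `w_i ↦ 0`, and then replace every `w_i` by `z_i`. The left
(right) summand of `σ ⊕ σ` indexes the variables `z` (the variables `w`). -/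
noncomputable def frozenPow [DecidableEq σ] (H : σ → NCPowerSeries σ K) (m : ℕ) :
    Module.End K (NCPowerSeries σ K) :=
  rename (Sum.elim id id) ∘ₗ
    (derivation (Sum.elim (fun i => rename Sum.inr (H i)) fun _ => 0) ^ m) ∘ₗ
      rename Sum.inl

end Rename

end NCPowerSeries

namespace CommPowerSeries

variable {σ K : Type*} [CommRing K] [Fintype σ]

/-- The `K`-derivation `[U ∂/∂z] = ∑ i, [U_i ∂/∂z_i]` of the algebra of formal power series in
commutative variables, which maps `z_i` to `U_i` for every `i`. -/
noncomputable def derivation (U : σ → MvPowerSeries σ K) : Module.End K (MvPowerSeries σ K) :=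
  ((∑ i, U i • MvPowerSeries.pderiv K i :
    Derivation K (MvPowerSeries σ K) (MvPowerSeries σ K)) :
      MvPowerSeries σ K →ₗ[K] MvPowerSeries σ K)

/-- The operator `[H(w) ∂/∂z]^m |_{w = z}` for commutative variables, where `w` is a second set of
commutative variables, independent of `z`. -/
noncomputable def frozenPow (H : σ → MvPowerSeries σ K) (m : ℕ) :
    Module.End K (MvPowerSeries σ K) :=
  (MvPowerSeries.rename (Sum.elim id id : σ ⊕ σ → σ)).toLinearMap ∘ₗ
    (derivation (Sum.elim (fun i => MvPowerSeries.rename Sum.inr (H i)) fun _ => 0) ^ m) ∘ₗ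
      (MvPowerSeries.rename (Sum.inl : σ → σ ⊕ σ)).toLinearMap

/-- The Jacobian matrix `JH = (∂H_i/∂z_j)`. -/
noncomputable def jacobian (H : σ → MvPowerSeries σ K) : Matrix σ σ (MvPowerSeries σ K) :=
  Matrix.of fun i j => MvPowerSeries.pderiv K j (H i)

/-- `∂^{|I|}/∂z^I`, for a multi-index `I`. -/
noncomputable def iteratedPderiv {n : ℕ} (I : Fin n → ℕ) :
    Module.End K (MvPowerSeries (Fin n) K) :=
  (List.ofFn fun i =>
    ((MvPowerSeries.pderiv K i : MvPowerSeries (Fin n) K →ₗ[K] MvPowerSeries (Fin n) K) ^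
      I i : Module.End K (MvPowerSeries (Fin n) K))).prod

end CommPowerSeries

section Psi

variable {σ K A : Type*} [CommRing K] [AddCommGroup A] [Module K A]

/-- The sequence `C_1 = H`, `C_m = [C_{m-1} ∂/∂z] H` for `m ≥ 2`, where `D U` is the derivation
`[U ∂/∂z]` (`C_0 = 0` is a dummy value). -/
def cSeq (D : (σ → A) → Module.End K A) (H : σ → A) : ℕ → σ → A
  | 0 => 0
  | 1 => H
  | m + 2 => fun i => D (cSeq D H (m + 1)) (H i)

/-- The derivation `ψ_m = [C_m ∂/∂z]`, for `m ≥ 1`. -/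
def psi (D : (σ → A) → Module.End K A) (H : σ → A) (m : ℕ) : Module.End K A :=
  D (cSeq D H m)

end Psi

/-- `w^I = w_{i_1} w_{i_2} ⋯ w_{i_k}` for the composition `I = (i_1, …, i_k)`. -/
def compositionProd {B : Type*} [Monoid B] (w : ℕ → B) {m : ℕ} (I : Composition m) : B :=
  (I.blocks.map w).prod

/-- `π_u(I) = ∏_j (i_1 + ⋯ + i_j)` for the composition `I = (i_1, …, i_k)`. -/
def piU {m : ℕ} (I : Composition m) : ℕ :=
  ∏ j ∈ range I.length, (I.blocks.take (j + 1)).sum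

/-! Put `T m = (1/m!) [H(w) ∂/∂z]^m |_{w=z}` and `E = ∑ T m t^m`. As the exponential of a derivation
between two substitutions, `E` is multiplicative, and `E z = z + t H`, because the derivation kills
every series in `w`. Let `Ψ(t) = ∑ ψ_{k+1} t^k`. Both `dE/dt` and `Ψ(-t) E` satisfy the Leibniz rule
relative to `E`, so they agree once they agree on the variables. There `dE/dt` gives `H`, and
`Ψ(-t)(z + t H)` telescopes to `C_1 = H`, since `ψ_k H = C_{k+1}`. Passing from polynomials to all
series is a density argument in the order filtration (`TopologicallyGenerates.eq_zero`). Comparing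
coefficients gives `(m+1) T_{m+1} = ∑ (-1)^k ψ_{k+1} T_{m-k}` (`succ_smul_eq_sum_psi`,
`succ_smul_frozen`). Unrolling this recursion, dividing by `m+1` each time a first block is split
off, produces the sum over compositions (`eq_sum_composition`). The argument uses only filtered
algebras with topological generators, so it covers both kinds of variables. The commutative
multi-index formula then follows from the multinomial theorem, since the operators `H_i(w) ∂/∂z_i`
commute. -/

/-! ### Reindexing of sums over `a + b + c = m`. -/

theorem sum_antidiagonal_antidiagonal_assoc {M : Type*} [AddCommMonoid M] (m : ℕ)
    (F : ℕ → ℕ → ℕ → M) :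
    ∑ p ∈ antidiagonal m, ∑ q ∈ antidiagonal p.2, F p.1 q.1 q.2 =
      ∑ p ∈ antidiagonal m, ∑ q ∈ antidiagonal p.1, F q.1 q.2 p.2 := by
  rw [sum_sigma', sum_sigma']
  refine sum_nbij' (fun x => ⟨(x.1.1 + x.2.1, x.2.2), (x.1.1, x.2.1)⟩)
    (fun x => ⟨(x.2.1, x.2.2 + x.1.2), (x.2.2, x.1.2)⟩) ?_ ?_ ?_ ?_ ?_ <;>
  · rintro ⟨⟨a, b⟩, ⟨c, d⟩⟩ h
    simp only [mem_sigma, HasAntidiagonal.mem_antidiagonal] at h ⊢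
    try grind

theorem sum_antidiagonal_antidiagonal_left_comm {M : Type*} [AddCommMonoid M] (m : ℕ)
    (F : ℕ → ℕ → ℕ → M) :
    ∑ p ∈ antidiagonal m, ∑ q ∈ antidiagonal p.2, F p.1 q.1 q.2 =
      ∑ p ∈ antidiagonal m, ∑ q ∈ antidiagonal p.2, F q.1 p.1 q.2 := by
  rw [sum_antidiagonal_antidiagonal_assoc, sum_antidiagonal_antidiagonal_assoc m fun a b c =>
    F b a c]
  refine sum_congr rfl fun p _ => ?_
  exact (Finset.Nat.sum_antidiagonal_swap (f := fun q => F q.1 q.2 p.2)).symm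

/-! ### Density in filtered algebras. -/

/-- The family `x` generates a dense subalgebra of `A` with respect to the separated decreasing
filtration `J`. -/
structure TopologicallyGenerates {σ A : Type*} (K : Type*) [CommRing K] [Ring A] [Algebra K A]
    (x : σ → A) (J : ℕ → Submodule K A) : Prop where
  antitone : Antitone J
  separated : ∀ f, (∀ N, f ∈ J N) → f = 0
  dense : ∀ N f, ∃ g ∈ Algebra.adjoin K (Set.range x), f - g ∈ J N

namespace TopologicallyGenerates

variable {σ K A : Type*} [CommRing K] [Ring A] [Algebra K A] {x : σ → A}
  {J : ℕ → Submodule K A}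

/-- A linear map that lowers the filtration by a bounded amount vanishes if it vanishes on the
subalgebra generated by `x`. -/
theorem eq_zero {τ B : Type*} [Ring B] [Algebra K B] {y : τ → B} {J' : ℕ → Submodule K B}
    (hA : TopologicallyGenerates K x J) (hB : TopologicallyGenerates K y J')
    (Φ : A →ₗ[K] B) (d : ℕ) (hΦ : ∀ N, ∀ f ∈ J (N + d), Φ f ∈ J' N)
    (h : ∀ f ∈ Algebra.adjoin K (Set.range x), Φ f = 0) : Φ = 0 := by
  ext f
  refine hB.separated _ fun N => ?_
  obtain ⟨g, hg, hfg⟩ := hA.dense (N + d) f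
  have := hΦ N _ hfg
  rwa [map_sub, h g hg, sub_zero] at this

/-- An algebra endomorphism that respects the filtration and fixes `x` is the identity. -/
theorem algHom_apply (hA : TopologicallyGenerates K x J) (Φ : A →ₐ[K] A)
    (hΦ : ∀ N, ∀ f ∈ J N, Φ f ∈ J N) (h : ∀ i, Φ (x i) = x i) (f : A) : Φ f = f := by
  have h0 : Φ.toLinearMap - LinearMap.id = 0 := by
    refine hA.eq_zero hA _ 0 (fun N f hf => ?_) fun f hf => ?_
    · exact sub_mem (hΦ N f hf) hf
    · have : Algebra.adjoin K (Set.range x) ≤ AlgHom.equalizer Φ (AlgHom.id K A) :=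
        Algebra.adjoin_le (by rintro _ ⟨i, rfl⟩; exact h i)
      exact sub_eq_zero.2 (this hf)
  exact sub_eq_zero.1 (LinearMap.congr_fun h0 f)

end TopologicallyGenerates

/-! ### Powers of a derivation. -/

section Leibniz

variable {K A : Type*} [CommRing K] [Ring A] [Algebra K A]

theorem leibniz_one {D : Module.End K A} (hD : ∀ f g, D (f * g) = D f * g + f * D g) :
    D 1 = 0 := by
  simpa using hD 1 1

/-- The general Leibniz rule. -/
theorem leibniz_pow {D : Module.End K A} (hD : ∀ f g, D (f * g) = D f * g + f * D g) (m : ℕ)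
    (f g : A) :
    (D ^ m) (f * g) =
      ∑ p ∈ antidiagonal m, m.choose p.1 • ((D ^ p.1) f * (D ^ p.2) g) := by
  induction m with
  | zero => simp
  | succ m ih =>
    rw [sum_antidiagonal_choose_succ_nsmul (fun i j => (D ^ i) f * (D ^ j) g) m]
    simp only [pow_succ', Module.End.mul_apply, ih, map_sum, map_nsmul, hD, smul_add,
      sum_add_distrib]
    rw [add_comm]
    congr 1
    refine sum_congr rfl fun p hp => ?_
    rw [Nat.choose_symm_of_eq_add (mem_antidiagonal.1 hp).symm]

end Leibniz

/-! ### The differential equation for `E`, coefficient by coefficient. -/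

section Recursion

variable {σ K A : Type*} [CommRing K] [Ring A] [Algebra K A] {x : σ → A}
  {J : ℕ → Submodule K A}

/-- The coefficientwise form of `(d/dt) E = Ψ(-t) E`, where `E = ∑ T_m t^m` is an algebra
homomorphism with `E z = z + t H`, and `Ψ(t) = ∑ ψ_{k+1} t^k`. -/
theorem succ_smul_eq_sum_psi (hA : TopologicallyGenerates K x J)
    (D : (σ → A) → Module.End K A) (hD : ∀ U f g, D U (f * g) = D U f * g + f * D U g)
    (hDx : ∀ U i, D U (x i) = U i) (hDJ : ∀ U N, ∀ f ∈ J (N + 1), D U f ∈ J N)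
    (H : σ → A) (T : ℕ → Module.End K A)
    (hmul : ∀ m f g, T m (f * g) = ∑ p ∈ antidiagonal m, T p.1 f * T p.2 g)
    (hone : ∀ m, T (m + 1) 1 = 0) (h0 : T 0 = 1) (h1 : ∀ i, T 1 (x i) = H i)
    (h2 : ∀ m i, T (m + 2) (x i) = 0) (hTJ : ∀ m N, ∀ f ∈ J (N + m), T m f ∈ J N) (m : ℕ) :
    ((m + 1 : ℕ) : K) • T (m + 1) =
      ∑ p ∈ antidiagonal m, (-1 : K) ^ p.1 • (psi D H (p.1 + 1) * T p.2) := by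
  set R : ℕ → Module.End K A := fun m =>
    ∑ p ∈ antidiagonal m, (-1 : K) ^ p.1 • (psi D H (p.1 + 1) * T p.2) with hR
  have hRapp : ∀ m f, R m f = ∑ p ∈ antidiagonal m,
      (-1 : K) ^ p.1 • psi D H (p.1 + 1) (T p.2 f) := by
    intro m f
    simp [hR, LinearMap.sum_apply]
  have hT1 : T 0 1 = 1 := by rw [h0]; rfl
  -- `E` is multiplicative and each `ψ_k` is a derivation, so `Ψ(-t) E` is a derivation along `E`.
  have hRmul : ∀ m f g, R m (f * g) =
      ∑ p ∈ antidiagonal m, R p.1 f * T p.2 g + ∑ p ∈ antidiagonal m, T p.1 f * R p.2 g := by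
    intro m f g
    simp only [hRapp, hmul, map_sum, smul_sum, sum_mul, mul_sum]
    rw [← sum_antidiagonal_antidiagonal_assoc m fun a b c =>
      (-1 : K) ^ a • psi D H (a + 1) (T b f) * T c g,
      sum_antidiagonal_antidiagonal_left_comm m fun a b c =>
      T a f * (-1 : K) ^ b • psi D H (b + 1) (T c g), ← sum_add_distrib]
    refine sum_congr rfl fun p _ => ?_
    rw [← sum_add_distrib]
    refine sum_congr rfl fun q _ => ?_
    rw [psi, hD, smul_add, smul_mul_assoc, mul_smul_comm]
  have hLmul : ∀ m f g, ((m + 1 : ℕ) : K) • T (m + 1) (f * g) =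
      ∑ p ∈ antidiagonal m, (((p.1 + 1 : ℕ) : K) • T (p.1 + 1) f) * T p.2 g +
        ∑ p ∈ antidiagonal m, T p.1 f * (((p.2 + 1 : ℕ) : K) • T (p.2 + 1) g) := by
    intro m f g
    -- The weight `m + 1` splits as `p.1 + p.2`. The boundary term of each half has weight zero,
    -- which permits the index shift.
    have e1 := Finset.Nat.sum_antidiagonal_succ (n := m)
      (f := fun p => ((p.1 : ℕ) : K) • (T p.1 f * T p.2 g))
    have e2 := Finset.Nat.sum_antidiagonal_succ' (n := m)
      (f := fun p => ((p.2 : ℕ) : K) • (T p.1 f * T p.2 g))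
    simp only [Nat.cast_zero, zero_smul, zero_add] at e1 e2
    simp only [smul_mul_assoc, mul_smul_comm]
    rw [← e1, ← e2, hmul, smul_sum]
    rw [← sum_add_distrib]
    refine sum_congr rfl fun p hp => ?_
    rw [← add_smul, ← Nat.cast_add, mem_antidiagonal.1 hp]
  have key : ∀ f ∈ Algebra.adjoin K (Set.range x), ∀ m,
      ((m + 1 : ℕ) : K) • T (m + 1) f = R m f := by
    intro f hf
    induction hf using Algebra.adjoin_induction with
    | mem y hy =>
      obtain ⟨i, rfl⟩ := hy
      intro m
      rw [hRapp]
      cases m with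
      | zero => simp [h1, h0, psi, cSeq, hDx]
      -- Only `T 0` and `T 1` are nonzero on a generator. The two surviving terms are `C_{m+2}` with
      -- opposite signs, because `ψ_{m+1} H = C_{m+2}`.
      | succ m =>
        rw [h2, smul_zero, Finset.Nat.sum_antidiagonal_succ']
        dsimp only
        cases m with
        | zero => simp [h0, h1, psi, cSeq, hDx]
        | succ m =>
          rw [Finset.Nat.sum_antidiagonal_succ', sum_eq_zero, h0, h1]
          · simp [psi, cSeq, hDx, pow_succ]
          · intro p _
            rw [h2, map_zero, smul_zero]
    | algebraMap r =>
      intro m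
      have hR1 : R m 1 = 0 := by
        rw [hRapp]
        refine sum_eq_zero fun p _ => ?_
        have : psi D H (p.1 + 1) (T p.2 1) = 0 := by
          cases p.2 with
          | zero => rw [hT1]; exact leibniz_one (hD _)
          | succ k => rw [hone, map_zero]
        rw [this, smul_zero]
      rw [Algebra.algebraMap_eq_smul_one, map_smul, map_smul, hone, hR1, smul_zero, smul_zero]
    | add f g _ _ ihf ihg => intro m; rw [map_add, map_add, smul_add, ihf, ihg]
    | mul f g _ _ ihf ihg => intro m; rw [hLmul, hRmul]; simp only [ihf, ihg]
  -- `T (m + 1)` lowers the filtration by at most `m + 1`, and `ψ_{k+1} T_l` by at most `1 + l ≤ m +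
  -- 1`.
  refine sub_eq_zero.1 (hA.eq_zero hA _ (m + 1) (fun N f hf => ?_) fun f hf => ?_)
  · refine sub_mem (Submodule.smul_mem _ _ (hTJ _ _ _ hf)) ?_
    rw [hRapp]
    refine sum_mem fun p hp => Submodule.smul_mem _ _ (hDJ _ _ _ (hTJ p.2 _ _ ?_))
    have := mem_antidiagonal.1 hp
    exact hA.antitone (by lia) hf
  · exact sub_eq_zero.2 (key f hf m)

end Recursion

/-! ### The frozen operators satisfy the recursion. -/

section Frozen

variable {σ τ K A B : Type*} [CommRing K] [Algebra ℚ K] [Ring A] [Algebra K A] [Ring B]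
  [Algebra K B] {x : σ → A} {J : ℕ → Submodule K A} {y : τ → B} {J' : ℕ → Submodule K B}

/-- Turns the binomial Leibniz rule into multiplicativity of the divided powers `D'^m / m!`. -/
theorem algebraMap_inv_factorial_mul_choose {m : ℕ} {p : ℕ × ℕ} (hp : p ∈ antidiagonal m) :
    algebraMap ℚ K (1 / (m ! : ℚ)) * (m.choose p.1 : K) =
      algebraMap ℚ K (1 / (p.1 ! : ℚ)) * algebraMap ℚ K (1 / (p.2 ! : ℚ)) := by
  rw [← map_natCast (algebraMap ℚ K), ← map_mul, ← map_mul]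
  congr 1
  obtain rfl := mem_antidiagonal.1 hp
  have h' : ((p.1 + p.2).choose p.1 : ℚ) * (p.1 ! : ℚ) * (p.2 ! : ℚ) = ((p.1 + p.2)! : ℚ) := by
    rw [Nat.choose_symm_add]
    exact_mod_cast Nat.add_choose_mul_factorial_mul_factorial p.1 p.2
  have a := Nat.cast_ne_zero (R := ℚ).2 (Nat.factorial_ne_zero p.1)
  have b := Nat.cast_ne_zero (R := ℚ).2 (Nat.factorial_ne_zero p.2)
  have c := Nat.cast_ne_zero (R := ℚ).2 (Nat.factorial_ne_zero (p.1 + p.2))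
  field_simp
  linarith

/-- The recursion `(m + 1) T_{m+1} = ∑_{k + l = m} (-1)^k ψ_{k+1} T_l` for the operators
`T_m = (1 / m!) [H(w) ∂/∂z]^m |_{w = z}`. -/
theorem succ_smul_frozen (hA : TopologicallyGenerates K x J) (hB : TopologicallyGenerates K y J')
    (D : (σ → A) → Module.End K A) (hD : ∀ U f g, D U (f * g) = D U f * g + f * D U g)
    (hDx : ∀ U i, D U (x i) = U i) (hDJ : ∀ U N, ∀ f ∈ J (N + 1), D U f ∈ J N)
    (H : σ → A) (D' : Module.End K B) (hD' : ∀ f g, D' (f * g) = D' f * g + f * D' g)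
    (hDJ' : ∀ N, ∀ f ∈ J' (N + 1), D' f ∈ J' N) (ι κ : A →ₐ[K] B) (ρ : B →ₐ[K] A)
    (hι : ∀ N, ∀ f ∈ J N, ι f ∈ J' N) (hκ : ∀ N, ∀ f ∈ J N, κ f ∈ J' N)
    (hρ : ∀ N, ∀ f ∈ J' N, ρ f ∈ J N) (hρι : ∀ i, ρ (ι (x i)) = x i)
    (hρκ : ∀ i, ρ (κ (x i)) = x i) (hDι : ∀ i, D' (ι (x i)) = κ (H i))
    (hDκ : ∀ i, D' (κ (x i)) = 0) (T : ℕ → Module.End K A)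
    (hT : ∀ m, T m = algebraMap ℚ K (1 / (m ! : ℚ)) •
      (ρ.toLinearMap ∘ₗ (D' ^ m) ∘ₗ ι.toLinearMap)) (m : ℕ) :
    T 0 = 1 ∧ ((m + 1 : ℕ) : K) • T (m + 1) =
      ∑ p ∈ antidiagonal m, (-1 : K) ^ p.1 • (psi D H (p.1 + 1) * T p.2) := by
  have hTa : ∀ m f, T m f = algebraMap ℚ K (1 / (m ! : ℚ)) • ρ ((D' ^ m) (ι f)) := by
    intro m f
    rw [hT]
    rfl
  -- Series in `w` are constants for `D'`: true on generators, hence everywhere by density.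
  have hκ0 : ∀ g, D' (κ g) = 0 := by
    refine LinearMap.congr_fun (f := D' ∘ₗ κ.toLinearMap) (hA.eq_zero hB _ 1 (fun N f hf => ?_)
      fun f hf => ?_)
    · exact hDJ' _ _ (hκ _ _ hf)
    · change D' (κ f) = 0
      induction hf using Algebra.adjoin_induction with
      | mem y hy => obtain ⟨i, rfl⟩ := hy; exact hDκ i
      | algebraMap r =>
        rw [Algebra.algebraMap_eq_smul_one, map_smul, map_smul, map_one, leibniz_one hD',
          smul_zero]
      | add f g _ _ ihf ihg => rw [map_add, map_add, ihf, ihg, add_zero]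
      | mul f g _ _ ihf ihg => rw [map_mul, hD', ihf, ihg, zero_mul, mul_zero, add_zero]
  have hρκ' : ∀ f, ρ (κ f) = f :=
    hA.algHom_apply (ρ.comp κ) (fun N f hf => hρ _ _ (hκ _ _ hf)) hρκ
  have hρι' : ∀ f, ρ (ι f) = f :=
    hA.algHom_apply (ρ.comp ι) (fun N f hf => hρ _ _ (hι _ _ hf)) hρι
  have h0 : T 0 = 1 := by
    ext f
    simp [hTa, hρι']
  refine ⟨h0, succ_smul_eq_sum_psi hA D hD hDx hDJ H T ?_ ?_ h0 ?_ ?_ ?_ m⟩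
  · intro m f g
    simp only [hTa, map_mul, leibniz_pow hD', map_sum, map_nsmul, smul_sum]
    refine sum_congr rfl fun p hp => ?_
    rw [← Nat.cast_smul_eq_nsmul K, smul_smul, algebraMap_inv_factorial_mul_choose hp,
      smul_mul_smul_comm]
  · intro m
    rw [hTa, map_one, pow_succ, Module.End.mul_apply, leibniz_one hD', map_zero, map_zero,
      smul_zero]
  · intro i
    simp [hTa, hDι, hρκ']
  · intro m i
    rw [hTa, pow_succ, pow_succ, Module.End.mul_apply, Module.End.mul_apply, hDι, hκ0, map_zero,
      map_zero, smul_zero]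
  · intro m N f hf
    rw [hTa]
    refine Submodule.smul_mem _ _ (hρ _ _ ?_)
    have hpow : ∀ m N, ∀ g ∈ J' (N + m), (D' ^ m) g ∈ J' N := by
      intro m
      induction m with
      | zero => intro N g hg; exact hg
      | succ m ih =>
        intro N g hg
        rw [pow_succ, Module.End.mul_apply]
        exact ih _ _ (hDJ' _ _ hg)
    exact hpow _ _ _ (hι _ _ hf)

end Frozen

/-! ### Solving the recursion by compositions. -/

section Compositions

/-- Prepending the block `k + 1` to a composition. -/
def Composition.consSucc {n : ℕ} (k : ℕ) (c : Composition n) {m : ℕ} (h : k + n = m) :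
    Composition (m + 1) where
  blocks := (k + 1) :: c.blocks
  blocks_pos := by
    intro i hi
    rcases List.mem_cons.1 hi with rfl | hi
    · exact Nat.succ_pos k
    · exact c.blocks_pos hi
  blocks_sum := by rw [List.sum_cons, c.blocks_sum]; lia

/-- Every composition of `m + 1` arises uniquely by prepending a block to a composition. -/
theorem sum_composition_succ {M : Type*} [AddCommMonoid M] (m : ℕ) (g : List ℕ → M) :
    ∑ I : Composition (m + 1), g I.blocks =
      ∑ p ∈ antidiagonal m, ∑ I : Composition p.2, g ((p.1 + 1) :: I.blocks) := by
  rw [sum_sigma']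
  symm
  refine sum_bij (fun a ha => a.2.consSucc a.1.1 (mem_antidiagonal.1 (mem_sigma.1 ha).1))
    (fun _ _ => mem_univ _) ?_ ?_ fun _ _ => rfl
  · rintro ⟨⟨a, b⟩, I⟩ ha ⟨⟨a', b'⟩, I'⟩ ha' h
    have hb := congrArg Composition.blocks h
    simp only [Composition.consSucc, List.cons.injEq, Nat.add_right_cancel_iff] at hb
    obtain ⟨rfl, hb⟩ := hb
    have : b = b' := I.blocks_sum.symm.trans (hb ▸ I'.blocks_sum)
    subst this
    rw [Composition.ext hb]
  · rintro ⟨l, hl, hs⟩ -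
    cases l with
    | nil => simp at hs
    | cons k l =>
      have hk : 0 < k := hl (by simp)
      rw [List.sum_cons] at hs
      refine ⟨⟨(k - 1, l.sum), ⟨l, fun hi => hl (List.mem_cons_of_mem _ hi), rfl⟩⟩, ?_, ?_⟩
      · simp only [mem_sigma, HasAntidiagonal.mem_antidiagonal, mem_univ, and_true]
        lia
      · ext1
        simp only [Composition.consSucc, List.cons.injEq, and_true]
        lia

/-- The product of the partial sums of a list. -/
def prodPartialSums (l : List ℕ) : ℕ :=
  ∏ j ∈ range l.length, (l.take (j + 1)).sum

/-- A block prepended to a composition comes last after reversal, so the old partial sums persist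
and the only new factor is the total sum. -/
theorem prodPartialSums_append_singleton (l : List ℕ) (k : ℕ) :
    prodPartialSums (l ++ [k]) = prodPartialSums l * (l.sum + k) := by
  rw [prodPartialSums, List.length_append, List.length_singleton, prod_range_succ,
    prodPartialSums]
  congr 1
  · refine prod_congr rfl fun j hj => ?_
    rw [List.take_append_of_le_length (mem_range.1 hj)]
  · rw [List.take_of_length_le (by simp), List.sum_append, List.sum_singleton]

variable {K B : Type*} [CommRing K] [Algebra ℚ K] [Ring B] [Algebra K B]

/-- The signed sum over all compositions of `m`, weighted by inverse products of partial sums,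
is determined by a recursion with respect to the first block. -/
theorem eq_sum_composition (T w : ℕ → B) (h0 : T 0 = 1)
    (h : ∀ m, ((m + 1 : ℕ) : K) • T (m + 1) =
      ∑ p ∈ antidiagonal m, (-1 : K) ^ p.1 • (w (p.1 + 1) * T p.2)) (m : ℕ) :
    T m = (-1 : K) ^ m • ∑ I : Composition m,
      algebraMap ℚ K ((-1) ^ I.length / (piU I.reverse : ℚ)) • compositionProd w I := by
  -- The summand depends only on the list of blocks, which makes compositions of different integers
  -- comparable.
  set g : List ℕ → B := fun l =>
    algebraMap ℚ K ((-1) ^ l.length / (prodPartialSums l.reverse : ℚ)) • (l.map w).prod with hg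
  have hsum : ∀ m, ∑ I : Composition m,
      algebraMap ℚ K ((-1) ^ I.length / (piU I.reverse : ℚ)) • compositionProd w I =
      ∑ I : Composition m, g I.blocks := fun _ => rfl
  simp only [hsum]
  induction m using Nat.strong_induction_on with
  | _ m ih =>
    cases m with
    | zero =>
      have huniq : ∀ I : Composition 0, I.blocks = [] := by
        rintro ⟨l, hl, hs⟩
        exact List.eq_nil_iff_forall_not_mem.2 fun i hi =>
          (hl hi).ne' (List.sum_eq_zero_iff.1 hs i hi)
      have : Unique (Composition 0) :=
        ⟨⟨⟨[], by simp, rfl⟩⟩, fun I => Composition.ext (huniq I)⟩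
      rw [h0, Fintype.sum_unique, huniq]
      simp [hg, prodPartialSums]
    | succ m =>
      have hinv : algebraMap ℚ K (1 / ((m + 1 : ℕ) : ℚ)) * ((m + 1 : ℕ) : K) = 1 := by
        rw [← map_natCast (algebraMap ℚ K), ← map_mul, one_div_mul_cancel, map_one]
        exact Nat.cast_ne_zero.2 (Nat.succ_ne_zero m)
      have hT : T (m + 1) = algebraMap ℚ K (1 / ((m + 1 : ℕ) : ℚ)) •
          ((m + 1 : ℕ) : K) • T (m + 1) := by
        rw [smul_smul, hinv, one_smul]
      rw [hT, h, sum_composition_succ, smul_sum,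
        smul_sum]
      refine sum_congr rfl fun p hp => ?_
      have hp' := mem_antidiagonal.1 hp
      rw [ih p.2 (by lia), mul_smul_comm, mul_sum, smul_smul, smul_smul, smul_sum, smul_sum]
      refine sum_congr rfl fun I _ => ?_
      -- The new factor of `π_u` is the total `p.2 + (p.1 + 1) = m + 1`, which matches the division
      -- by `m + 1`.
      simp only [hg, List.map_cons, List.prod_cons, List.reverse_cons, List.length_cons,
        prodPartialSums_append_singleton, List.sum_reverse, I.blocks_sum, mul_smul_comm,
        smul_smul]
      congr 1
      have e : p.2 + (p.1 + 1) = m + 1 := by lia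
      have s : ((-1 : K)) ^ (m + 1) = -((-1) ^ p.1 * (-1) ^ p.2) := by
        rw [← hp']; ring
      rw [e, s, Nat.cast_mul, pow_succ, show ((-1 : ℚ) ^ I.blocks.length * -1) /
        ((prodPartialSums I.blocks.reverse : ℚ) * ((m + 1 : ℕ) : ℚ)) =
        -((1 / ((m + 1 : ℕ) : ℚ)) * ((-1) ^ I.blocks.length /
          (prodPartialSums I.blocks.reverse : ℚ))) by ring, map_neg, map_mul]
      ring

end Compositions

/-! ### Noncommutative series: filtration by word length. -/

namespace NCPowerSeries

variable {σ τ K : Type*} [CommRing K]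

/-- The series all of whose coefficients at words of length less than `N` vanish. -/
def orderGE (σ K : Type*) [CommRing K] (N : ℕ) : Submodule K (NCPowerSeries σ K) where
  carrier := {f | ∀ w : List σ, w.length < N → f w = 0}
  add_mem' hf hg w hw := by rw [add_apply, hf w hw, hg w hw, add_zero]
  zero_mem' _ _ := rfl
  smul_mem' c f hf w hw := by rw [smul_apply, hf w hw, mul_zero]

theorem X_mul_nil [DecidableEq σ] (i : σ) (f : NCPowerSeries σ K) :
    ((X i : NCPowerSeries σ K) * f) [] = 0 := by
  simp [mul_nil, X]

theorem X_mul_cons [DecidableEq σ] (i a : σ) (f : NCPowerSeries σ K) (w : List σ) :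
    ((X i : NCPowerSeries σ K) * f) (a :: w) = if a = i then f w else 0 := by
  rw [mul_cons, tailAt_X]
  split_ifs <;> simp [X, zero_apply]

/-- Splitting words by their first letter drives the induction for density. -/
theorem eq_smul_one_add_sum [Fintype σ] [DecidableEq σ] (f : NCPowerSeries σ K) :
    f = f [] • 1 + ∑ i, X i * tailAt i f := by
  ext w
  rw [add_apply, smul_apply, sum_apply]
  cases w with
  | nil => simp [one_nil, X_mul_nil]
  | cons a w => simp [one_cons, X_mul_cons, tailAt]

theorem topologicallyGenerates [Fintype σ] [DecidableEq σ] :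
    TopologicallyGenerates K (X : σ → NCPowerSeries σ K) (orderGE σ K) where
  antitone _ _ h _ hf w hw := hf w (hw.trans_le h)
  separated f hf := by
    ext w
    exact hf (w.length + 1) w (Nat.lt_succ_self _)
  dense N := by
    induction N with
    | zero => exact fun f => ⟨0, zero_mem _, fun w hw => absurd hw (Nat.not_lt_zero _)⟩
    | succ N ih =>
      intro f
      -- Each tail is needed only to order `N`, since multiplication by `X i` gains one.
      choose g hg hfg using fun i => ih (tailAt i f)
      refine ⟨f [] • 1 + ∑ i, X i * g i, ?_, ?_⟩
      · exact add_mem (Subalgebra.smul_mem _ (one_mem _) _) (sum_mem fun i _ =>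
          mul_mem (Algebra.subset_adjoin ⟨i, rfl⟩) (hg i))
      · have h : f - (f [] • 1 + ∑ i, X i * g i) = ∑ i, X i * (tailAt i f - g i) := by
          conv_lhs => rw [eq_smul_one_add_sum f]
          simp only [mul_sub, sum_sub_distrib, add_apply, smul_apply, one_nil, mul_one,
            sum_apply, X_mul_nil, sum_const_zero, add_zero]
          abel
        rw [h]
        refine sum_mem fun i _ w hw => ?_
        cases w with
        | nil => exact X_mul_nil _ _
        | cons a w =>
          rw [X_mul_cons]
          split_ifs
          · exact hfg i w (Nat.lt_of_succ_lt_succ hw)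
          · rfl

theorem derivation_mem_orderGE [Fintype σ] (U : σ → NCPowerSeries σ K) (N : ℕ)
    {f : NCPowerSeries σ K} (hf : f ∈ orderGE σ K (N + 1)) : derivation U f ∈ orderGE σ K N := by
  intro w hw
  rw [derivation_apply]
  refine sum_eq_zero fun j hj => sum_eq_zero fun l hl => sum_eq_zero fun i _ => ?_
  -- The word fed to `f` trades a factor of `w` for a single letter, so it has length at most
  -- `w.length + 1`.
  rw [hf, mul_zero]
  simp only [List.length_append, List.length_cons, List.length_take, List.length_drop]
  lia

theorem rename_mem_orderGE [Fintype σ] [DecidableEq τ] (e : σ → τ) (N : ℕ)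
    {f : NCPowerSeries σ K} (hf : f ∈ orderGE σ K N) : rename e f ∈ orderGE τ K N := by
  intro w hw
  change ∑ v : Fin w.length → σ with (List.ofFn v).map e = w, f (List.ofFn v) = 0
  exact sum_eq_zero fun v _ => hf _ (by rwa [List.length_ofFn])

theorem rename_one [Fintype σ] [DecidableEq τ] (e : σ → τ) :
    rename e (1 : NCPowerSeries σ K) = 1 := by
  ext w
  cases w with
  | nil => rw [rename_nil, one_nil, one_nil]
  | cons a w =>
    have h : ∀ j, tailAt j (1 : NCPowerSeries σ K) = 0 := fun _ => rfl
    simp [rename_cons, h, one_cons, zero_apply]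

/-- The substitution `z_i ↦ z_{e i}` as an algebra homomorphism. -/
noncomputable def renameAlgHom [Fintype σ] [DecidableEq τ] (e : σ → τ) :
    NCPowerSeries σ K →ₐ[K] NCPowerSeries τ K :=
  AlgHom.ofLinearMap (rename e) (rename_one e) (rename_mul e)

theorem frozenPow_eq_sum_composition [Algebra ℚ K] [Fintype σ] [DecidableEq σ]
    (H : σ → NCPowerSeries σ K) (m : ℕ) :
    algebraMap ℚ K (1 / (m ! : ℚ)) • frozenPow H m =
      (-1 : K) ^ m • ∑ I : Composition m,
        algebraMap ℚ K ((-1) ^ I.length / (piU I.reverse : ℚ)) •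
          compositionProd (psi derivation H) I := by
  have h := succ_smul_frozen (K := K) topologicallyGenerates topologicallyGenerates derivation
    derivation_mul derivation_X (fun U N f hf => derivation_mem_orderGE U N hf) H
    (derivation (Sum.elim (fun i => rename Sum.inr (H i)) fun _ => 0)) (derivation_mul _)
    (fun N f hf => derivation_mem_orderGE _ N hf) (renameAlgHom Sum.inl) (renameAlgHom Sum.inr)
    (renameAlgHom (Sum.elim id id)) (fun N f hf => rename_mem_orderGE _ N hf)
    (fun N f hf => rename_mem_orderGE _ N hf) (fun N f hf => rename_mem_orderGE _ N hf)
    (fun i => by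
      change rename _ (rename _ _) = _
      rw [rename_X, rename_X]; rfl)
    (fun i => by
      change rename _ (rename _ _) = _
      rw [rename_X, rename_X]; rfl)
    (fun i => by
      change derivation _ (rename _ _) = _
      rw [rename_X, derivation_X]; rfl)
    (fun i => by
      change derivation _ (rename _ _) = _
      rw [rename_X, derivation_X]; rfl)
    (fun m => algebraMap ℚ K (1 / (m ! : ℚ)) • frozenPow H m) (fun m => rfl)
  exact eq_sum_composition (fun m => algebraMap ℚ K (1 / (m ! : ℚ)) • frozenPow H m)
    (psi derivation H) (h 0).1 (fun m => (h m).2) m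

end NCPowerSeries

/-! ### Commutative series: filtration by total degree. -/

namespace CommPowerSeries

variable {σ τ K : Type*} [CommRing K]

/-- The series all of whose coefficients of total degree less than `N` vanish. -/
def orderGE (σ K : Type*) [CommRing K] (N : ℕ) : Submodule K (MvPowerSeries σ K) where
  carrier := {f | ∀ d : σ →₀ ℕ, d.degree < N → MvPowerSeries.coeff d f = 0}
  add_mem' hf hg w hw := by rw [map_add, hf w hw, hg w hw, add_zero]
  zero_mem' _ _ := rfl
  smul_mem' c f hf w hw := by rw [map_smul, hf w hw, smul_zero]

theorem mul_mem_orderGE (g : MvPowerSeries σ K) {N : ℕ} {f : MvPowerSeries σ K}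
    (hf : f ∈ orderGE σ K N) : g * f ∈ orderGE σ K N := by
  classical
  intro d hd
  rw [MvPowerSeries.coeff_mul]
  refine sum_eq_zero fun p hp => ?_
  rw [hf, mul_zero]
  rw [← HasAntidiagonal.mem_antidiagonal.1 hp, map_add] at hd
  lia

theorem pderiv_mem_orderGE (i : σ) (N : ℕ) {f : MvPowerSeries σ K}
    (hf : f ∈ orderGE σ K (N + 1)) : MvPowerSeries.pderiv K i f ∈ orderGE σ K N := by
  intro d hd
  rw [MvPowerSeries.coeff_pderiv, hf, zero_mul]
  rw [map_add, Finsupp.degree_single]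
  lia

theorem derivation_apply [Fintype σ] (U : σ → MvPowerSeries σ K) (f : MvPowerSeries σ K) :
    derivation U f = ∑ i, U i * MvPowerSeries.pderiv K i f := by
  change Derivation.coeFnAddMonoidHom (∑ i, U i • MvPowerSeries.pderiv K i) f = _
  rw [map_sum, Finset.sum_apply]
  rfl

theorem derivation_mul [Fintype σ] (U : σ → MvPowerSeries σ K) (f g : MvPowerSeries σ K) :
    derivation U (f * g) = derivation U f * g + f * derivation U g := by
  simp only [derivation, Derivation.coeFn_coe, Derivation.leibniz, smul_eq_mul]
  ring

theorem derivation_X [Fintype σ] (U : σ → MvPowerSeries σ K) (i : σ) :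
    derivation U (MvPowerSeries.X i) = U i := by
  classical
  simp [derivation_apply, MvPowerSeries.pderiv_X, Pi.single_apply]

theorem derivation_mem_orderGE [Fintype σ] (U : σ → MvPowerSeries σ K) (N : ℕ)
    {f : MvPowerSeries σ K} (hf : f ∈ orderGE σ K (N + 1)) : derivation U f ∈ orderGE σ K N := by
  rw [derivation_apply]
  exact sum_mem fun i _ => mul_mem_orderGE _ (pderiv_mem_orderGE i N hf)

theorem rename_mem_orderGE (e : σ → τ) [Filter.TendstoCofinite e] (N : ℕ)
    {f : MvPowerSeries σ K} (hf : f ∈ orderGE σ K N) :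
    MvPowerSeries.rename e f ∈ orderGE τ K N := by
  intro d hd
  rw [MvPowerSeries.coeff_rename]
  refine sum_eq_zero fun v hv => hf v ?_
  have hv' : Finsupp.mapDomain e v = d := by simpa using hv
  rwa [← hv', Finsupp.degree_mapDomain] at hd

theorem coe_mem_adjoin (p : MvPolynomial σ K) : (p : MvPowerSeries σ K) ∈
    Algebra.adjoin K (Set.range (MvPowerSeries.X : σ → MvPowerSeries σ K)) := by
  induction p using MvPolynomial.induction_on with
  | C a =>
    rw [MvPolynomial.coe_C]
    exact Subalgebra.algebraMap_mem _ a
  | add p q hp hq => rw [MvPolynomial.coe_add]; exact add_mem hp hq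
  | mul_X p i hp =>
    rw [MvPolynomial.coe_mul, MvPolynomial.coe_X]
    exact mul_mem hp (Algebra.subset_adjoin ⟨i, rfl⟩)

theorem topologicallyGenerates [Finite σ] :
    TopologicallyGenerates K (MvPowerSeries.X : σ → MvPowerSeries σ K) (orderGE σ K) where
  antitone _ _ h _ hf w hw := hf w (hw.trans_le h)
  separated f hf := by
    ext w
    exact hf (w.degree + 1) w (Nat.lt_succ_self _)
  dense N f := by
    refine ⟨(MvPowerSeries.truncTotal N f : MvPolynomial σ K), coe_mem_adjoin _, fun d hd => ?_⟩
    rw [map_sub, MvPolynomial.coeff_coe, MvPowerSeries.coeff_truncTotal _ hd, sub_self]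

theorem frozenPow_eq_sum_composition [Algebra ℚ K] [Fintype σ]
    (H : σ → MvPowerSeries σ K) (m : ℕ) :
    algebraMap ℚ K (1 / (m ! : ℚ)) • frozenPow H m =
      (-1 : K) ^ m • ∑ I : Composition m,
        algebraMap ℚ K ((-1) ^ I.length / (piU I.reverse : ℚ)) •
          compositionProd (psi derivation H) I := by
  have h := succ_smul_frozen (K := K) topologicallyGenerates topologicallyGenerates derivation
    derivation_mul derivation_X (fun U N f hf => derivation_mem_orderGE U N hf) H
    (derivation (Sum.elim (fun i => MvPowerSeries.rename Sum.inr (H i)) fun _ => 0))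
    (derivation_mul _) (fun N f hf => derivation_mem_orderGE _ N hf)
    (MvPowerSeries.rename (Sum.inl : σ → σ ⊕ σ)) (MvPowerSeries.rename (Sum.inr : σ → σ ⊕ σ))
    (MvPowerSeries.rename (Sum.elim id id : σ ⊕ σ → σ))
    (fun N f hf => rename_mem_orderGE _ N hf)
    (fun N f hf => rename_mem_orderGE _ N hf) (fun N f hf => rename_mem_orderGE _ N hf)
    (fun i => by simp) (fun i => by simp) (fun i => by simp [derivation_X])
    (fun i => by simp [derivation_X])
    (fun m => algebraMap ℚ K (1 / (m ! : ℚ)) • frozenPow H m) (fun m => rfl)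
  exact eq_sum_composition (fun m => algebraMap ℚ K (1 / (m ! : ℚ)) • frozenPow H m)
    (psi derivation H) (h 0).1 (fun m => (h m).2) m

/-- By the chain rule `[U ∂/∂z] H = JH · U`, so each step of the sequence multiplies by the
Jacobian. -/
theorem cSeq_succ [Fintype σ] [DecidableEq σ] (H : σ → MvPowerSeries σ K) (m : ℕ) :
    cSeq derivation H (m + 1) = (jacobian H ^ m).mulVec H := by
  induction m with
  | zero => simp [cSeq]
  | succ m ih =>
    rw [pow_succ', ← Matrix.mulVec_mulVec, ← ih]
    ext1 i
    change derivation (cSeq derivation H (m + 1)) (H i) = _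
    rw [derivation_apply]
    simp [Matrix.mulVec, dotProduct, jacobian, mul_comm]

theorem pderiv_rename_of_notMem (e : σ → τ) [Filter.TendstoCofinite e] {j : τ}
    (hj : j ∉ Set.range e) (f : MvPowerSeries σ K) :
    MvPowerSeries.pderiv K j (MvPowerSeries.rename e f) = 0 := by
  classical
  ext d
  rw [MvPowerSeries.coeff_pderiv, MvPowerSeries.coeff_rename_eq_zero, zero_mul, map_zero]
  rintro ⟨v, hv⟩
  have := congrArg (fun u => u j) hv
  simp [Finsupp.mapDomain_of_notMem_range _ _ hj] at this

theorem pderiv_rename (e : σ ↪ τ) (i : σ) (f : MvPowerSeries σ K) :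
    MvPowerSeries.pderiv K (e i) (MvPowerSeries.rename e f) =
      MvPowerSeries.rename e (MvPowerSeries.pderiv K i f) := by
  classical
  ext d
  by_cases hd : d ∈ Set.range (Finsupp.mapDomain e)
  · obtain ⟨v, rfl⟩ := hd
    have h : Finsupp.mapDomain e v + Finsupp.single (e i) 1 =
        Finsupp.embDomain e (v + Finsupp.single i 1) := by
      rw [Finsupp.embDomain_eq_mapDomain, Finsupp.mapDomain_add, Finsupp.mapDomain_single]
    rw [MvPowerSeries.coeff_pderiv, h, MvPowerSeries.coeff_embDomain_rename,
      ← Finsupp.embDomain_eq_mapDomain, MvPowerSeries.coeff_embDomain_rename,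
      MvPowerSeries.coeff_pderiv, Finsupp.embDomain_apply_self]
  · rw [MvPowerSeries.coeff_rename_eq_zero _ _ hd, MvPowerSeries.coeff_pderiv,
      MvPowerSeries.coeff_rename_eq_zero, zero_mul]
    rintro ⟨v, hv⟩
    -- The exponent `d + single (e i) 1` is positive at `e i`, so `v i ≥ 1` and one unit can be
    -- removed, placing `d` in the image.
    refine hd ⟨v - Finsupp.single i 1, ?_⟩
    have hv1 : v = (v - Finsupp.single i 1) + Finsupp.single i 1 := by
      refine (tsub_add_cancel_of_le ?_).symm
      rw [Finsupp.single_le_iff, ← Finsupp.mapDomain_apply e.injective v i, hv]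
      simp
    rw [hv1, Finsupp.mapDomain_add, Finsupp.mapDomain_single] at hv
    exact add_right_cancel hv

end CommPowerSeries

/-! ### Jacobian form of `ψ_m` and the multi-index expansion. -/

namespace CommPowerSeries

variable {K : Type*} [CommRing K]

theorem psi_eq_sum {σ : Type*} [Fintype σ] [DecidableEq σ] (H : σ → MvPowerSeries σ K) {m : ℕ}
    (hm : 1 ≤ m) (u : MvPowerSeries σ K) :
    psi derivation H m u =
      ∑ i, ((jacobian H ^ (m - 1)).mulVec H) i * MvPowerSeries.pderiv K i u := by
  obtain ⟨k, rfl⟩ := Nat.exists_eq_add_of_le' hm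
  rw [psi, cSeq_succ, derivation_apply, Nat.add_sub_cancel]

/-- The operator `H_i(w) ∂/∂z_i` on series in two sets of variables `z` and `w`. -/
noncomputable def frozenPartial {σ : Type*} [Finite σ] (H : σ → MvPowerSeries σ K) (i : σ) :
    Module.End K (MvPowerSeries (σ ⊕ σ) K) :=
  LinearMap.mulLeft K (MvPowerSeries.rename Sum.inr (H i)) ∘ₗ
    (MvPowerSeries.pderiv K (Sum.inl i : σ ⊕ σ) :
      MvPowerSeries (σ ⊕ σ) K →ₗ[K] MvPowerSeries (σ ⊕ σ) K)

section FrozenPartial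

variable {σ : Type*} [Finite σ] (H : σ → MvPowerSeries σ K)

theorem frozenPartial_apply (i : σ) (f : MvPowerSeries (σ ⊕ σ) K) :
    frozenPartial H i f =
      MvPowerSeries.rename Sum.inr (H i) * MvPowerSeries.pderiv K (Sum.inl i) f := rfl

theorem pderiv_inl_rename_inr_mul (i : σ) (g : MvPowerSeries σ K)
    (f : MvPowerSeries (σ ⊕ σ) K) :
    MvPowerSeries.pderiv K (Sum.inl i) (MvPowerSeries.rename Sum.inr g * f) =
      MvPowerSeries.rename Sum.inr g * MvPowerSeries.pderiv K (Sum.inl i) f := by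
  rw [Derivation.leibniz, pderiv_rename_of_notMem _ (by simp), smul_zero, add_zero, smul_eq_mul]

theorem pderiv_pderiv_comm {τ : Type*} (i j : τ) (f : MvPowerSeries τ K) :
    MvPowerSeries.pderiv K i (MvPowerSeries.pderiv K j f) =
      MvPowerSeries.pderiv K j (MvPowerSeries.pderiv K i f) := by
  classical
  ext d
  simp only [MvPowerSeries.coeff_pderiv, Finsupp.add_apply, add_right_comm d]
  by_cases h : i = j
  · subst h; rfl
  · simp [h, Ne.symm h, mul_right_comm]

/-- The coefficients `H_i(w)` are constant in `z`. This is where freezing `w` matters: it permits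
the multinomial theorem. -/
theorem frozenPartial_commute (i j : σ) : Commute (frozenPartial H i) (frozenPartial H j) := by
  refine LinearMap.ext fun f => ?_
  simp only [Module.End.mul_apply, frozenPartial_apply, pderiv_inl_rename_inr_mul]
  rw [pderiv_pderiv_comm, mul_left_comm]

/-- Products `g(w) u(z)` are stable under these operators; the factor `g` lets different indices be
applied in succession. -/
theorem frozenPartial_pow_apply (i : σ) (k : ℕ) (g u : MvPowerSeries σ K) :
    (frozenPartial H i ^ k) (MvPowerSeries.rename Sum.inr g * MvPowerSeries.rename Sum.inl u) =
      MvPowerSeries.rename Sum.inr (H i ^ k * g) * MvPowerSeries.rename Sum.inl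
        (((MvPowerSeries.pderiv K i : MvPowerSeries σ K →ₗ[K] MvPowerSeries σ K) ^ k :
          Module.End K (MvPowerSeries σ K)) u) := by
  induction k with
  | zero => simp
  | succ k ih =>
    rw [pow_succ', Module.End.mul_apply, ih, frozenPartial_apply, pderiv_inl_rename_inr_mul,
      pow_succ' (_ : Module.End K (MvPowerSeries σ K)), Module.End.mul_apply, pow_succ',
      mul_assoc (H i), map_mul _ (H i), mul_assoc]
    congr 2
    exact pderiv_rename Function.Embedding.inl i _

theorem prod_frozenPartial_pow_apply (I : σ → ℕ) (l : List σ) (u : MvPowerSeries σ K) :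
    ((l.map fun i => frozenPartial H i ^ I i).prod) (MvPowerSeries.rename Sum.inl u) =
      MvPowerSeries.rename Sum.inr ((l.map fun i => H i ^ I i).prod) *
        MvPowerSeries.rename Sum.inl ((l.map fun i =>
          ((MvPowerSeries.pderiv K i : MvPowerSeries σ K →ₗ[K] MvPowerSeries σ K) ^ I i :
            Module.End K (MvPowerSeries σ K))).prod u) := by
  induction l with
  | nil => simp
  | cons i l ih =>
    rw [List.map_cons, List.prod_cons, Module.End.mul_apply, ih, frozenPartial_pow_apply]
    rfl

end FrozenPartial

variable {n : ℕ} (H : Fin n → MvPowerSeries (Fin n) K)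

theorem derivation_frozen_eq_sum :
    derivation (Sum.elim (fun i => MvPowerSeries.rename Sum.inr (H i)) fun _ => 0) =
      ∑ i, frozenPartial H i := by
  refine LinearMap.ext fun f => ?_
  simp [derivation_apply, frozenPartial_apply, LinearMap.sum_apply]

theorem frozenPow_eq_sum_piAntidiag (m : ℕ) (u : MvPowerSeries (Fin n) K) :
    frozenPow H m u = ∑ I ∈ piAntidiag (univ : Finset (Fin n)) m,
      Nat.multinomial univ I • ((∏ i, H i ^ I i) * iteratedPderiv (K := K) I u) := by
  change MvPowerSeries.rename _ ((derivation _ ^ m) (MvPowerSeries.rename _ u)) = _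
  rw [derivation_frozen_eq_sum, sum_pow_eq_sum_piAntidiag_of_commute _ _
    (fun i _ j _ _ => frozenPartial_commute H i j), LinearMap.sum_apply, map_sum]
  refine sum_congr rfl fun I _ => ?_
  -- Fixes the order of the factors as in `Fin n`, to match the list product in `iteratedPderiv`.
  have hprod : univ.noncommProd (fun i => frozenPartial H i ^ I i)
      (fun i _ j _ _ => (frozenPartial_commute H i j).pow_pow _ _) =
      ((List.finRange n).map fun i => frozenPartial H i ^ I i).prod := by
    rw [← noncommProd_toFinset _ _ (fun i _ j _ _ => (frozenPartial_commute H i j).pow_pow _ _)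
      (List.nodup_finRange n)]
    exact noncommProd_congr (by ext; simp) (fun _ _ => rfl) _
  rw [hprod, ← nsmul_eq_mul, LinearMap.smul_apply, map_nsmul, prod_frozenPartial_pow_apply,
    map_mul, MvPowerSeries.rename_rename, MvPowerSeries.rename_rename, ← List.ofFn_eq_map,
    ← List.ofFn_eq_map, List.prod_ofFn]
  simp [iteratedPderiv]

theorem smul_frozenPow_eq_sum_piAntidiag [Algebra ℚ K] (m : ℕ) (u : MvPowerSeries (Fin n) K) :
    (algebraMap ℚ K (1 / (m ! : ℚ)) • frozenPow H m) u =
      ∑ I ∈ piAntidiag (univ : Finset (Fin n)) m,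
        algebraMap ℚ K (1 / ((∏ i, (I i)! : ℕ) : ℚ)) •
          ((∏ i, H i ^ I i) * iteratedPderiv (K := K) I u) := by
  rw [LinearMap.smul_apply, frozenPow_eq_sum_piAntidiag, smul_sum]
  refine sum_congr rfl fun I hI => ?_
  rw [← Nat.cast_smul_eq_nsmul K, smul_smul, ← map_natCast (algebraMap ℚ K), ← map_mul]
  congr 2
  have h := Nat.multinomial_spec univ I
  rw [(mem_piAntidiag.1 hI).1] at h
  have h1 : ((∏ i, (I i)! : ℕ) : ℚ) ≠ 0 :=
    Nat.cast_ne_zero.2 (prod_ne_zero_iff.2 fun i _ => Nat.factorial_ne_zero _)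
  have h2 : (m ! : ℚ) ≠ 0 := Nat.cast_ne_zero.2 (Nat.factorial_ne_zero _)
  rw [one_div_mul_eq_div, div_eq_div_iff h2 h1, one_mul, ← Nat.cast_mul, mul_comm, h]

end CommPowerSeries

theorem mainTheorem10 {K : Type*} [CommRing K] [Algebra ℚ K] (n m : ℕ) (hm : 1 ≤ m) :
    (∀ H : Fin n → NCPowerSeries (Fin n) K,
      algebraMap ℚ K (1 / (m ! : ℚ)) • NCPowerSeries.frozenPow H m =
        (-1 : K) ^ m • ∑ I : Composition m,
          algebraMap ℚ K ((-1) ^ I.length / (piU I.reverse : ℚ)) •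
            compositionProd (psi NCPowerSeries.derivation H) I) ∧
    (∀ H : Fin n → MvPowerSeries (Fin n) K,
      algebraMap ℚ K (1 / (m ! : ℚ)) • CommPowerSeries.frozenPow H m =
        (-1 : K) ^ m • ∑ I : Composition m,
          algebraMap ℚ K ((-1) ^ I.length / (piU I.reverse : ℚ)) •
            compositionProd (psi CommPowerSeries.derivation H) I ∧
      (∀ u : MvPowerSeries (Fin n) K,
        psi CommPowerSeries.derivation H m u =
          ∑ i : Fin n, ((CommPowerSeries.jacobian H ^ (m - 1)).mulVec H) i *
            MvPowerSeries.pderiv K i u) ∧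
      (∀ u : MvPowerSeries (Fin n) K,
        ∑ I ∈ Finset.piAntidiag (Finset.univ : Finset (Fin n)) m,
            algebraMap ℚ K (1 / ((∏ i, (I i)! : ℕ) : ℚ)) •
              ((∏ i, H i ^ I i) * CommPowerSeries.iteratedPderiv (K := K) I u) =
          ((-1 : K) ^ m • ∑ I : Composition m,
            algebraMap ℚ K ((-1) ^ I.length / (piU I.reverse : ℚ)) •
              compositionProd (psi CommPowerSeries.derivation H) I) u)) := by
  refine ⟨fun H => NCPowerSeries.frozenPow_eq_sum_composition H m, fun H =>
    ⟨CommPowerSeries.frozenPow_eq_sum_composition H m,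
      fun u => CommPowerSeries.psi_eq_sum H hm u, fun u => ?_⟩⟩
  rw [← CommPowerSeries.frozenPow_eq_sum_composition,
    CommPowerSeries.smul_frozenPow_eq_sum_piAntidiag]
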